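/- Consider the resource-constrained joint replenishment problem with $n$ commodities and $D$ resources: a joint ordering cost $K_0\ge 0$, individual ordering costs $K_i>0$, holding cost coefficients $H_i>0$, and resource consumption coefficients $\alpha_{id}\ge 0$. A policy is a vector $T=(T_1,\dots,T_n)$ of positive time intervals. It is resource-feasible if $\sum_i \alpha_{id}/T_i\le 1$ for every $d\in[D]$, and its long-run average cost is $$F(T)=K_0\cdot\lim_{\Delta\to\infty}\frac{\left|\bigcup_{i\in[n]}\{0,T_i,2T_i,\dots,\lfloor \Delta/T_i\rfloor T_i\}\right|}{\Delta}+\sum_{i\in[n]}\left(\frac{K_i}{T_i}+H_iT_i\right).$$ The convex relaxation (P) minimizes $\frac{K_0}{T_{\min}}+\sum_{i}\left(\frac{K_i}{T_i}+H_iT_i\right)$ subject to $T_i\ge T_{\min}>0$ for every $i\in[n]$ and $\sum_i\alpha_{id}/T_i\le 1$ for every $d\in[D]$; its optimal value is denoted $\mathrm{OPT}(\mathrm{P})$. Let $(T^*_{\min},T^*_1,\dots,T^*_n)$ be an optimal solution of (P), and let $\tilde T_{\min},\tilde T_1,\dots,\tilde T_n$ be obtained by rounding each of its entries up to the nearest integer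 power of $2^{1/N}$, where $N=2000$. For integers $m\ge2$, $k\ge1$ and a shift $\Theta\in[0,1]$, let $\tilde T^{m,k,\Theta}$ be the policy whose $i$-th time interval is $$\tilde T^{m,k,\Theta}_i=\min\left\{g>\tilde T_i \;:\; g=m^{(p+\Theta)/k}\,\tilde T_{\min}\text{ for some }p\in\mathbb Z\right\}.$$ Lemma. There is a shift $\Theta\in[0,1]$ such that $\tilde T^{2,1,\Theta}$ and $\tilde T^{2,2,\Theta}$ are both resource-feasible and $$\min\left\{F(\tilde T^{2,1,\Theta}),\,F(\tilde T^{2,2,\Theta})\right\}\le 1.2512\cdot\mathrm{OPT}(\mathrm{P}).$$ -/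

import Mathlib

open Filter Topology

/-- An instance of the resource-constrained joint replenishment problem with `n` commodities and
`D` resources: the joint ordering cost `K₀`, individual ordering costs `K i`, holding cost
coefficients `H i`, and the normalized resource consumption coefficients `α i d`
(all capacities are equal to one). -/
structure RCJRP (n D : ℕ) where
  K₀ : ℝ
  K : Fin n → ℝ
  H : Fin n → ℝ
  α : Fin n → Fin D → ℝ
  K₀_nonneg : 0 ≤ K₀
  K_pos : ∀ i, 0 < K i
  H_pos : ∀ i, 0 < H i
  α_nonneg : ∀ i d, 0 ≤ α i d

/-- The integer multiples `0, g, 2g, …, ⌊Δ / g⌋ g` of `g` within `[0, Δ]`. -/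
def multiplesUpTo (g Δ : ℝ) : Set ℝ :=
  {x | ∃ q : ℕ, q ≤ ⌊Δ / g⌋₊ ∧ x = (q : ℝ) * g}

/-- The number of joint orders placed across `[0, Δ]` by the policy with time intervals `T`. -/
noncomputable def numJointOrders {n : ℕ} (T : Fin n → ℝ) (Δ : ℝ) : ℕ :=
  (⋃ i, multiplesUpTo (T i) Δ).ncard

/-- The asymptotic density of joint orders; the limit exists for all positive `T`, see
`tendsto_numJointOrders`. -/
noncomputable def orderDensity {n : ℕ} (T : Fin n → ℝ) : ℝ :=
  limUnder atTop (fun Δ : ℝ => (numJointOrders T Δ : ℝ) / Δ)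

namespace RCJRP

variable {n D : ℕ}

/-- A vector of time intervals satisfies all resource constraints. -/
def ResourceFeasible (I : RCJRP n D) (T : Fin n → ℝ) : Prop :=
  (∀ i, 0 < T i) ∧ ∀ d, ∑ i, I.α i d / T i ≤ 1

/-- The long-run average operational cost `F(T) = J(T) + ∑ i, (K i / T i + H i * T i)`. -/
noncomputable def cost (I : RCJRP n D) (T : Fin n → ℝ) : ℝ :=
  I.K₀ * orderDensity T + ∑ i, (I.K i / T i + I.H i * T i)

/-- The objective function of the convex relaxation. -/
noncomputable def relaxObj (I : RCJRP n D) (Tmin : ℝ) (T : Fin n → ℝ) : ℝ :=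
  I.K₀ / Tmin + ∑ i, (I.K i / T i + I.H i * T i)

/-- Feasibility for the convex relaxation. The point `Tmin = 0`, where the objective is `+∞`, is
not in its domain. -/
def RelaxFeasible (I : RCJRP n D) (Tmin : ℝ) (T : Fin n → ℝ) : Prop :=
  0 < Tmin ∧ (∀ i, Tmin ≤ T i) ∧ ∀ d, ∑ i, I.α i d / T i ≤ 1

/-- `(Tmin, T)` is an optimal solution of the convex relaxation. -/
def RelaxOptimal (I : RCJRP n D) (Tmin : ℝ) (T : Fin n → ℝ) : Prop :=
  I.RelaxFeasible Tmin T ∧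
    ∀ (Tmin' : ℝ) (T' : Fin n → ℝ), I.RelaxFeasible Tmin' T' →
      I.relaxObj Tmin T ≤ I.relaxObj Tmin' T'

/-- The optimal value of the convex relaxation. -/
noncomputable def relaxOPT (I : RCJRP n D) : ℝ :=
  sInf {v | ∃ (Tmin : ℝ) (T : Fin n → ℝ), I.RelaxFeasible Tmin T ∧ v = I.relaxObj Tmin T}

end RCJRP

/-- `t` rounded up to the nearest integer power of `2^(1/N)` (powers are kept fixed). -/
noncomputable def roundPow (N : ℕ) (t : ℝ) : ℝ :=
  sInf {g : ℝ | (∃ p : ℤ, g = (2 : ℝ) ^ ((p : ℝ) / (N : ℝ))) ∧ t ≤ g}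

/-- The shifted geometric grid `{m^((p + Θ)/k) * Tmin : p ∈ ℤ}`. -/
def shiftedGrid (m k : ℕ) (Θ Tmin : ℝ) : Set ℝ :=
  {g | ∃ p : ℤ, g = (m : ℝ) ^ (((p : ℝ) + Θ) / (k : ℝ)) * Tmin}

/-- `t` rounded up to the nearest strictly greater point of the shifted geometric grid. -/
noncomputable def roundGrid (m k : ℕ) (Θ Tmin t : ℝ) : ℝ :=
  sInf {g | g ∈ shiftedGrid m k Θ Tmin ∧ t < g}

/-- The shifted policy obtained from `(Tmin, T)` by first rounding every entry (including the
anchor `Tmin` of the grid) up to a power of `2^(1/N)`, and then rounding the resulting time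
intervals up to the shifted grid. -/
noncomputable def shiftedPolicy {n : ℕ} (N m k : ℕ) (Θ Tmin : ℝ) (T : Fin n → ℝ) : Fin n → ℝ :=
  fun i => roundGrid m k Θ (roundPow N Tmin) (roundPow N (T i))

/-! Well-definedness: the minima and the limit above exist. -/

theorem exists_isLeast_rpow {b c t : ℝ} (hb : 1 < b) (hc : 0 < c) (ht : 0 < t) :
    (∃ p : ℤ, t ≤ b ^ (p : ℝ) * c ∧ ∀ q : ℤ, t ≤ b ^ (q : ℝ) * c → p ≤ q) ∧
    (∃ p : ℤ, t < b ^ (p : ℝ) * c ∧ ∀ q : ℤ, t < b ^ (q : ℝ) * c → p ≤ q) := by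
  have h0 : 0 < t / c := div_pos ht hc
  have hle : ∀ q : ℤ, t ≤ b ^ (q : ℝ) * c ↔ Real.logb b (t / c) ≤ q := fun q => by
    rw [← div_le_iff₀ hc, Real.logb_le_iff_le_rpow hb h0]
  have hlt : ∀ q : ℤ, t < b ^ (q : ℝ) * c ↔ Real.logb b (t / c) < q := fun q => by
    rw [← div_lt_iff₀ hc, Real.logb_lt_iff_lt_rpow hb h0]
  refine ⟨⟨⌈Real.logb b (t / c)⌉, (hle _).2 (Int.le_ceil _), fun q hq =>
    Int.ceil_le.2 ((hle q).1 hq)⟩, ⟨⌊Real.logb b (t / c)⌋ + 1, (hlt _).2 ?_, fun q hq => ?_⟩⟩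
  · push_cast; exact Int.lt_floor_add_one _
  · have := Int.floor_lt.2 ((hlt q).1 hq)
    omega

theorem roundPow_isLeast {N : ℕ} (hN : 1 ≤ N) {t : ℝ} (ht : 0 < t) :
    IsLeast {g : ℝ | (∃ p : ℤ, g = (2 : ℝ) ^ ((p : ℝ) / (N : ℝ))) ∧ t ≤ g} (roundPow N t) := by
  have hN' : (0 : ℝ) < N := by exact_mod_cast hN
  have hb : (1 : ℝ) < 2 ^ (1 / (N : ℝ)) := Real.one_lt_rpow (by norm_num) (by positivity)
  have key : ∀ p : ℤ, ((2 : ℝ) ^ (1 / (N : ℝ))) ^ (p : ℝ) * 1 = 2 ^ ((p : ℝ) / (N : ℝ)) := by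
    intro p
    rw [mul_one, ← Real.rpow_mul (by norm_num)]
    congr 1; ring
  obtain ⟨⟨p, hp, hmin⟩, -⟩ := exists_isLeast_rpow hb one_pos ht
  have h : IsLeast {g : ℝ | (∃ p : ℤ, g = (2 : ℝ) ^ ((p : ℝ) / (N : ℝ))) ∧ t ≤ g}
      ((2 : ℝ) ^ ((p : ℝ) / (N : ℝ))) := by
    refine ⟨⟨⟨p, rfl⟩, key p ▸ hp⟩, ?_⟩
    rintro _ ⟨⟨q, rfl⟩, hq⟩
    have : p ≤ q := hmin q (by rw [key]; exact hq)
    have : (p : ℝ) ≤ q := by exact_mod_cast this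
    exact Real.rpow_le_rpow_of_exponent_le (by norm_num) (by gcongr)
  have h2 : roundPow N t = (2 : ℝ) ^ ((p : ℝ) / (N : ℝ)) := h.csInf_eq
  rw [h2]; exact h

theorem roundGrid_isLeast {m k : ℕ} (hm : 2 ≤ m) (hk : 1 ≤ k) (Θ : ℝ) {Tmin t : ℝ}
    (hT : 0 < Tmin) (ht : 0 < t) :
    IsLeast {g | g ∈ shiftedGrid m k Θ Tmin ∧ t < g} (roundGrid m k Θ Tmin t) := by
  have hk' : (0 : ℝ) < k := by exact_mod_cast hk
  have hm1 : (1 : ℝ) < m := by exact_mod_cast hm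
  have hm0 : (0 : ℝ) < m := by linarith
  have hb : (1 : ℝ) < (m : ℝ) ^ (1 / (k : ℝ)) := Real.one_lt_rpow hm1 (by positivity)
  have hc : 0 < (m : ℝ) ^ (Θ / k) * Tmin := by positivity
  have key : ∀ p : ℤ, ((m : ℝ) ^ (1 / (k : ℝ))) ^ (p : ℝ) * ((m : ℝ) ^ (Θ / k) * Tmin)
      = (m : ℝ) ^ (((p : ℝ) + Θ) / (k : ℝ)) * Tmin := by
    intro p
    rw [← Real.rpow_mul hm0.le, ← mul_assoc, ← Real.rpow_add hm0]
    congr 2; ring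
  obtain ⟨-, ⟨p, hp, hmin⟩⟩ := exists_isLeast_rpow hb hc ht
  have h : IsLeast {g | g ∈ shiftedGrid m k Θ Tmin ∧ t < g}
      ((m : ℝ) ^ (((p : ℝ) + Θ) / (k : ℝ)) * Tmin) := by
    refine ⟨⟨⟨p, rfl⟩, key p ▸ hp⟩, ?_⟩
    rintro _ ⟨⟨q, rfl⟩, hq⟩
    have : p ≤ q := hmin q (by rw [key]; exact hq)
    have : (p : ℝ) ≤ q := by exact_mod_cast this
    refine mul_le_mul_of_nonneg_right ?_ hT.le
    exact Real.rpow_le_rpow_of_exponent_le hm1.le (by gcongr)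
  have h2 : roundGrid m k Θ Tmin t = _ := h.csInf_eq
  rw [h2]; exact h

theorem multiplesUpTo_finite (g Δ : ℝ) : (multiplesUpTo g Δ).Finite := by
  refine ((Set.finite_Iic ⌊Δ / g⌋₊).image (fun q : ℕ => (q : ℝ) * g)).subset ?_
  rintro x ⟨q, hq, rfl⟩
  exact ⟨q, hq, rfl⟩

theorem multiplesUpTo_eq {g Δ : ℝ} (hg : 0 < g) (hΔ : 0 ≤ Δ) :
    multiplesUpTo g Δ = (AddSubgroup.zmultiples g : Set ℝ) ∩ Set.Icc 0 Δ := by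
  ext x
  constructor
  · rintro ⟨q, hq, rfl⟩
    refine ⟨⟨(q : ℤ), by simp⟩, by positivity, ?_⟩
    rw [← le_div_iff₀ hg]
    exact (Nat.le_floor_iff (by positivity)).1 hq
  · rintro ⟨⟨z, rfl⟩, h0, h1⟩
    simp only [zsmul_eq_mul] at h0 h1 ⊢
    have hz : 0 ≤ z := by
      have : (0 : ℝ) ≤ z := nonneg_of_mul_nonneg_left h0 hg
      exact_mod_cast this
    lift z to ℕ using hz
    refine ⟨z, (Nat.le_floor_iff (by positivity)).2 ?_, by simp⟩
    rw [le_div_iff₀ hg]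
    simpa using h1

theorem ncard_multiplesUpTo {g : ℝ} (hg : 0 < g) (Δ : ℝ) :
    (multiplesUpTo g Δ).ncard = ⌊Δ / g⌋₊ + 1 := by
  have : multiplesUpTo g Δ = (fun q : ℕ => (q : ℝ) * g) '' (Set.Iic ⌊Δ / g⌋₊) := by
    ext x
    constructor
    · rintro ⟨q, hq, rfl⟩
      exact ⟨q, hq, rfl⟩
    · rintro ⟨q, hq, rfl⟩
      exact ⟨q, hq, rfl⟩
  rw [this, Set.ncard_image_of_injective]
  · rw [← Finset.coe_Iic, Set.ncard_coe_finset]; simp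
  · intro a b hab
    have := mul_right_cancel₀ hg.ne' hab
    exact_mod_cast this

theorem tendsto_ncard_zmultiples (g : ℝ) :
    ∃ l : ℝ, Tendsto (fun Δ : ℝ =>
      (((AddSubgroup.zmultiples g : Set ℝ) ∩ Set.Icc 0 Δ).ncard : ℝ) / Δ) atTop (𝓝 l) := by
  wlog hg : 0 ≤ g generalizing g
  · have := this (-g) (by linarith)
    rwa [AddSubgroup.zmultiples_neg] at this
  rcases hg.eq_or_lt with rfl | hg
  · refine ⟨0, (tendsto_inv_atTop_zero (𝕜 := ℝ)).congr' ?_⟩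
    filter_upwards [eventually_ge_atTop 0] with Δ hΔ
    have : ((AddSubgroup.zmultiples (0 : ℝ) : Set ℝ) ∩ Set.Icc 0 Δ) = {0} := by
      ext x
      simp only [AddSubgroup.zmultiples_zero_eq_bot, AddSubgroup.coe_bot, Set.mem_inter_iff,
        Set.mem_singleton_iff, Set.mem_Icc, and_iff_left_iff_imp]
      rintro rfl
      exact ⟨le_rfl, hΔ⟩
    rw [this]; simp
  · refine ⟨g⁻¹ + 0, ?_⟩
    have h1 := tendsto_nat_floor_mul_div_atTop (R := ℝ) (a := g⁻¹) (by positivity)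
    refine (h1.add tendsto_inv_atTop_zero).congr' ?_
    filter_upwards [eventually_ge_atTop 0] with Δ hΔ
    rw [← multiplesUpTo_eq hg hΔ, ncard_multiplesUpTo hg]
    push_cast
    rw [add_div, one_div, div_eq_mul_inv Δ g, mul_comm Δ]

theorem zmultiples_inf (a b : ℝ) :
    ∃ c : ℝ, AddSubgroup.zmultiples a ⊓ AddSubgroup.zmultiples b = AddSubgroup.zmultiples c := by
  obtain ⟨z, hz⟩ := Int.subgroup_cyclic
    ((AddSubgroup.zmultiples b).comap (zmultiplesHom ℝ a))
  rw [← AddSubgroup.zmultiples_eq_closure] at hz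
  refine ⟨z * a, ?_⟩
  ext x
  simp only [AddSubgroup.mem_inf, AddSubgroup.mem_zmultiples_iff]
  constructor
  · rintro ⟨⟨p, rfl⟩, hb⟩
    have : p ∈ (AddSubgroup.zmultiples b).comap (zmultiplesHom ℝ a) := by
      rw [AddSubgroup.mem_comap, AddSubgroup.mem_zmultiples_iff]
      simpa using hb
    rw [hz, AddSubgroup.mem_zmultiples_iff] at this
    obtain ⟨q, rfl⟩ := this
    exact ⟨q, by simp [mul_assoc]⟩
  · rintro ⟨q, rfl⟩
    have : q * z ∈ (AddSubgroup.zmultiples b).comap (zmultiplesHom ℝ a) := by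
      rw [hz, AddSubgroup.mem_zmultiples_iff]
      exact ⟨q, by simp⟩
    rw [AddSubgroup.mem_comap, AddSubgroup.mem_zmultiples_iff] at this
    refine ⟨⟨q * z, by simp [mul_assoc]⟩, ?_⟩
    obtain ⟨r, hr⟩ := this
    exact ⟨r, by simpa [mul_assoc] using hr⟩

theorem tendsto_ncard_iUnion {n : ℕ} (s : Finset (Fin n)) : ∀ g : Fin n → ℝ,
    ∃ l : ℝ, Tendsto (fun Δ : ℝ =>
      (((⋃ i ∈ s, (AddSubgroup.zmultiples (g i) : Set ℝ)) ∩ Set.Icc 0 Δ).ncard : ℝ) / Δ)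
      atTop (𝓝 l) := by
  have hfin : ∀ (a Δ : ℝ), ((AddSubgroup.zmultiples a : Set ℝ) ∩ Set.Icc 0 Δ).Finite := by
    intro a Δ
    wlog ha : 0 ≤ a generalizing a
    · have := this (-a) (by linarith)
      rwa [AddSubgroup.zmultiples_neg] at this
    rcases ha.eq_or_lt with rfl | ha
    · refine (Set.finite_singleton (0 : ℝ)).subset fun x hx => ?_
      simpa using hx.1
    · rcases lt_or_ge Δ 0 with hΔ | hΔ
      · simp [Set.Icc_eq_empty (not_le.2 hΔ)]
      · rw [← multiplesUpTo_eq ha hΔ]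
        exact multiplesUpTo_finite a Δ
  induction s using Finset.induction_on with
  | empty => exact fun g => ⟨0, by simp⟩
  | insert a s ha ih =>
    intro g
    choose c hc using fun i => zmultiples_inf (g a) (g i)
    obtain ⟨l₁, h₁⟩ := tendsto_ncard_zmultiples (g a)
    obtain ⟨l₂, h₂⟩ := ih g
    obtain ⟨l₃, h₃⟩ := ih c
    refine ⟨l₁ + l₂ - l₃, ((h₁.add h₂).sub h₃).congr fun Δ => ?_⟩
    set A := (AddSubgroup.zmultiples (g a) : Set ℝ) ∩ Set.Icc 0 Δ
    set U := (⋃ i ∈ s, (AddSubgroup.zmultiples (g i) : Set ℝ)) ∩ Set.Icc 0 Δ with hU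
    have hUf : U.Finite := by
      rw [hU, Set.iUnion₂_inter]
      exact Set.Finite.biUnion s.finite_toSet fun i _ => hfin _ _
    have e1 : (⋃ i ∈ insert a s, (AddSubgroup.zmultiples (g i) : Set ℝ)) ∩ Set.Icc 0 Δ
        = A ∪ U := by
      rw [Finset.set_biUnion_insert, Set.union_inter_distrib_right]
    have e2 : (⋃ i ∈ s, (AddSubgroup.zmultiples (c i) : Set ℝ)) ∩ Set.Icc 0 Δ = A ∩ U := by
      have : ∀ i, (AddSubgroup.zmultiples (c i) : Set ℝ)
          = (AddSubgroup.zmultiples (g a) : Set ℝ) ∩ (AddSubgroup.zmultiples (g i) : Set ℝ) :=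
        fun i => by rw [← hc, AddSubgroup.coe_inf]
      simp only [this, A, hU, ← Set.inter_iUnion₂]
      ext x; simp only [Set.mem_inter_iff]; tauto
    have := Set.ncard_union_add_ncard_inter A U (hfin _ _) hUf
    have h' : ((A ∪ U).ncard : ℝ) + (A ∩ U).ncard = A.ncard + U.ncard := by exact_mod_cast this
    rw [e1, e2, ← add_div, ← sub_div]
    congr 1
    linarith

theorem tendsto_numJointOrders {n : ℕ} {T : Fin n → ℝ} (hT : ∀ i, 0 < T i) :
    Tendsto (fun Δ : ℝ => (numJointOrders T Δ : ℝ) / Δ) atTop (𝓝 (orderDensity T)) := by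
  obtain ⟨l, hl⟩ := tendsto_ncard_iUnion Finset.univ T
  refine tendsto_nhds_limUnder ⟨l, hl.congr' ?_⟩
  filter_upwards [eventually_ge_atTop 0] with Δ hΔ
  have : (⋃ i, multiplesUpTo (T i) Δ)
      = (⋃ i ∈ Finset.univ, (AddSubgroup.zmultiples (T i) : Set ℝ)) ∩ Set.Icc 0 Δ := by
    rw [Set.iUnion₂_inter]
    simp [multiplesUpTo_eq (hT _) hΔ]
  rw [numJointOrders, this]

/-! The argument is an averaging one. Write `x = K₀ / Tmin` and let `C` be the remaining cost of the
relaxed optimum, so OPT(P) is `x + C`. If the claim fails, both policies are too expensive at every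
shift, so the two families may be sampled at different shifts.

In units of 1/2000 of an octave, shift index `j` divides the joint cost by about `2^(j/2000)`, with
an extra factor `1 + 1/√2` for the finer grid, `k = 2`. It stretches commodity `i` by an amount
depending only on the residue of `j - a i`, modulo 2000 for `k = 1` and modulo 1000 for `k = 2`. The
`k = 1` shifts `j` and `j + 1000` together stretch `i` exactly `1 + √2` times as much as the `k = 2`
shift `j`. Hence one may take, for each `j < 1000`, either that pair with unit weights or the `k =
2` policy with weight `1 + √2`: the total stretch is then a full sum over residues, independent of
`a i`. Small `j` has the largest joint cost, so the pairs are used for `j < 259` and the finer grid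
beyond.

The resulting inequality is linear in `x` and `C`. Scaling up the optimum stays feasible, which
forces `x ≤ C`, so only `x = 0` and `x = C` need numerical verification. -/

/-! ### Upper bound on the density of joint orders. -/

theorem orderDensity_le_sum {n : ℕ} {T : Fin n → ℝ} (hT : ∀ i, 0 < T i) (S : Finset ℕ)
    {c : ℕ → ℝ} (hc : ∀ l ∈ S, 0 < c l) (h : ∀ i, ∃ l ∈ S, ∃ m : ℕ, T i = m * c l) :
    orderDensity T ≤ ∑ l ∈ S, (c l)⁻¹ := by
  have hlim : Tendsto (fun Δ : ℝ => ∑ l ∈ S, ((c l)⁻¹ + Δ⁻¹)) atTop (𝓝 (∑ l ∈ S, (c l)⁻¹)) := by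
    refine tendsto_finsetSum _ fun l _ => ?_
    simpa using (tendsto_const_nhds (x := (c l)⁻¹)).add (tendsto_inv_atTop_zero (𝕜 := ℝ))
  refine le_of_tendsto_of_tendsto (tendsto_numJointOrders hT) hlim ?_
  filter_upwards [eventually_gt_atTop 0] with Δ hΔ
  -- Union bound: each order time is a multiple of some `c l`. The extra order at time 0 costs
  -- `Δ⁻¹`, which vanishes in the limit.
  have hsub : (⋃ i, multiplesUpTo (T i) Δ) ⊆ ⋃ l ∈ S, multiplesUpTo (c l) Δ := by
    refine Set.iUnion_subset fun i => ?_
    obtain ⟨l, hl, m, hm⟩ := h i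
    refine Set.Subset.trans ?_ (Set.subset_biUnion_of_mem (u := fun l => multiplesUpTo (c l) Δ) hl)
    rw [multiplesUpTo_eq (hT i) hΔ.le, multiplesUpTo_eq (hc l hl) hΔ.le]
    refine Set.inter_subset_inter_left _ ?_
    rintro _ ⟨z, rfl⟩
    exact ⟨z * m, by simp [hm, mul_assoc]⟩
  have hcard : numJointOrders T Δ ≤ ∑ l ∈ S, (⌊Δ / c l⌋₊ + 1) := by
    refine (Set.ncard_le_ncard hsub
      (S.finite_toSet.biUnion fun l _ => multiplesUpTo_finite _ _)).trans ?_
    refine (Finset.set_ncard_biUnion_le S _).trans (Finset.sum_le_sum fun l hl => ?_)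
    rw [ncard_multiplesUpTo (hc l hl)]
  have hcard' : (numJointOrders T Δ : ℝ) ≤ ∑ l ∈ S, (Δ / c l + 1) := by
    refine (Nat.cast_le.2 hcard).trans ?_
    push_cast
    refine Finset.sum_le_sum fun l hl => ?_
    have := Nat.floor_le (div_nonneg hΔ.le (hc l hl).le)
    linarith
  rw [div_le_iff₀ hΔ, Finset.sum_mul]
  refine hcard'.trans_eq (Finset.sum_congr rfl fun l _ => ?_)
  field_simp

/-! ### Rounding in exponent arithmetic. -/

theorem exists_roundPow_eq {N : ℕ} (hN : 1 ≤ N) {t : ℝ} (ht : 0 < t) :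
    ∃ p : ℤ, roundPow N t = (2 : ℝ) ^ ((p : ℝ) / N) ∧ t ≤ roundPow N t ∧
      roundPow N t ≤ 2 ^ (1 / (N : ℝ)) * t := by
  obtain ⟨⟨⟨p, hp⟩, hle⟩, hmin⟩ := roundPow_isLeast hN ht
  refine ⟨p, hp, hle, ?_⟩
  have hN' : (0 : ℝ) < N := by exact_mod_cast hN
  have h1 : (2 : ℝ) ^ (((p - 1 : ℤ) : ℝ) / N) ≤ t := by
    by_contra! hlt
    have h2 := hmin ⟨⟨p - 1, rfl⟩, hlt.le⟩
    rw [hp, Real.rpow_le_rpow_left_iff one_lt_two, div_le_div_iff_of_pos_right hN'] at h2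
    push_cast at h2
    linarith
  calc roundPow N t = 2 ^ (1 / (N : ℝ)) * (2 : ℝ) ^ (((p - 1 : ℤ) : ℝ) / N) := by
        rw [hp, ← Real.rpow_add two_pos]
        congr 1
        push_cast
        ring
    _ ≤ _ := by gcongr

theorem roundPow_mono {N : ℕ} (hN : 1 ≤ N) {s t : ℝ} (hs : 0 < s) (hst : s ≤ t) :
    roundPow N s ≤ roundPow N t :=
  (roundPow_isLeast hN hs).2
    ⟨(roundPow_isLeast hN (hs.trans_le hst)).1.1, hst.trans (roundPow_isLeast hN (hs.trans_le hst)).1.2⟩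

/-- Rounding `2^(c/N)` up to the grid anchored at `2^(b/N)` with shift `(j + δ)/M`, where
`N = k * M` and `0 < δ < 1`. -/
theorem roundGrid_two_eq {k M N : ℕ} (hk : 0 < k) (hM : 0 < M) (hN : N = k * M) (j b c : ℤ)
    {δ : ℝ} (hδ : 0 < δ) (hδ' : δ < 1) :
    roundGrid 2 k ((j + δ) / M) ((2 : ℝ) ^ ((b : ℝ) / N)) ((2 : ℝ) ^ ((c : ℝ) / N)) =
      2 ^ ((((j - (c - b)) % M : ℤ) + δ) / N) * 2 ^ ((c : ℝ) / N) := by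
  have hk' : (0 : ℝ) < k := by exact_mod_cast hk
  have hM' : (0 : ℝ) < M := by exact_mod_cast hM
  have hMz : (0 : ℤ) < M := by exact_mod_cast hM
  have hN' : (N : ℝ) = k * M := by exact_mod_cast hN
  have hN0 : (0 : ℝ) < N := by rw [hN']; positivity
  have hgrid : ∀ p : ℤ, ((2 : ℕ) : ℝ) ^ (((p : ℝ) + (j + δ) / M) / k) * (2 : ℝ) ^ ((b : ℝ) / N)
      = 2 ^ ((p * M + j + b + δ) / N : ℝ) := by
    intro p
    rw [Nat.cast_ofNat, ← Real.rpow_add two_pos, hN']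
    congr 1
    field_simp
    ring
  set s : ℤ := (j - (c - b)) % M with hs
  have hs0 : 0 ≤ s := Int.emod_nonneg _ hMz.ne'
  have hsM : s < M := Int.emod_lt_of_pos _ hMz
  have hdiv := Int.emod_add_mul_ediv (j - (c - b)) M
  have hs0' : (0 : ℝ) ≤ s := by exact_mod_cast hs0
  rw [← Real.rpow_add two_pos]
  refine IsLeast.csInf_eq ⟨⟨⟨-((j - (c - b)) / M), ?_⟩, ?_⟩, ?_⟩
  · rw [hgrid, ← add_div]
    congr 2
    have : (s : ℝ) + M * ((j - (c - b)) / M : ℤ) = j - (c - b) := by exact_mod_cast hdiv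
    push_cast
    linarith
  · rw [Real.rpow_lt_rpow_left_iff one_lt_two]
    have : 0 < (s + δ) / N := by positivity
    linarith
  · rintro _ ⟨⟨p, rfl⟩, hp⟩
    rw [hgrid] at hp ⊢
    rw [Real.rpow_lt_rpow_left_iff one_lt_two, div_lt_div_iff_of_pos_right hN0] at hp
    rw [Real.rpow_le_rpow_left_iff one_lt_two, ← add_div, div_le_div_iff_of_pos_right hN0]
    -- Since `δ < 1`, strict rounding above `c` becomes a weak inequality between integers; `0 < δ`
    -- made the candidate itself strictly larger.
    have h1 : c < p * M + j + b + 1 := by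
      have : (c : ℝ) < p * M + j + b + 1 := by linarith
      exact_mod_cast this
    have h2 : s + c ≤ p * M + j + b := by
      have h3 : -((j - (c - b)) / M) ≤ p := by
        by_contra! h4
        have : (M : ℤ) * (p + (j - (c - b)) / M) ≤ M * (-1) :=
          mul_le_mul_of_nonneg_left (by omega) hMz.le
        rw [mul_add] at this
        have e := mul_comm p (M : ℤ)
        omega
      have := mul_le_mul_of_nonneg_left h3 hMz.le
      rw [mul_neg] at this
      have e := mul_comm p (M : ℤ)
      omega
    have : (s : ℝ) + c ≤ p * M + j + b := by exact_mod_cast h2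
    linarith

/-- Relative to the base point, a rounded interval is `2^(p/k)` with `p ≥ 0`, because `j - (c - b) <
M`. Removing the integer factor `2^⌊p/k⌋` leaves only `k` possible generators, one per residue of
`p`. -/
theorem two_rpow_grid_multiple {k M N : ℕ} (hk : 0 < k) (hM : 0 < M) (hN : N = k * M) {j b c : ℤ}
    (hj : j < M) (hbc : b ≤ c) (δ : ℝ) :
    ∃ l ∈ Finset.range k, ∃ m : ℕ,
      (2 : ℝ) ^ ((((j - (c - b)) % M : ℤ) + δ) / N) * 2 ^ ((c : ℝ) / N) =
        m * (2 ^ ((l : ℝ) / k) * (2 ^ ((j + δ) / N : ℝ) * 2 ^ ((b : ℝ) / N))) := by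
  have hk' : (0 : ℝ) < k := by exact_mod_cast hk
  have hM' : (0 : ℝ) < M := by exact_mod_cast hM
  have hMz : (0 : ℤ) < M := by exact_mod_cast hM
  have hN' : (N : ℝ) = k * M := by exact_mod_cast hN
  have hs0 : 0 ≤ (j - (c - b)) % M := Int.emod_nonneg _ hMz.ne'
  have hdiv := Int.emod_add_mul_ediv (j - (c - b)) M
  obtain ⟨p, hp⟩ : ∃ p : ℕ, -((j - (c - b)) / M) = p := by
    refine Int.eq_ofNat_of_zero_le ?_
    by_contra! h4
    have : (M : ℤ) * 1 ≤ M * ((j - (c - b)) / M) :=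
      mul_le_mul_of_nonneg_left (by omega) hMz.le
    omega
  refine ⟨p % k, Finset.mem_range.2 (Nat.mod_lt _ hk), 2 ^ (p / k), ?_⟩
  have e1 : (((j - (c - b)) % M : ℤ) : ℝ) = j - (c - b) + M * p := by
    have : (j - (c - b)) % M = j - (c - b) + M * p := by rw [← hp, mul_neg]; omega
    rw [this]
    push_cast
    ring
  have e2 : (p : ℝ) = (p % k : ℕ) + k * (p / k : ℕ) := by exact_mod_cast (Nat.mod_add_div p k).symm
  rw [e1, Nat.cast_pow, Nat.cast_ofNat, ← Real.rpow_natCast]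
  simp only [← Real.rpow_add two_pos]
  congr 1
  rw [hN']
  field_simp
  linear_combination ((M : ℝ)) * e2

/-! ### Consequences of relaxed optimality, and the cost of a shifted policy. -/

namespace RCJRP

variable {n D : ℕ}

/-- Scaling up an optimal solution shows that the holding costs are at least the ordering costs. -/
theorem RelaxOptimal.ordering_le_holding {I : RCJRP n D} {Tmin : ℝ} {T : Fin n → ℝ}
    (hT : I.RelaxOptimal Tmin T) :
    I.K₀ / Tmin + ∑ i, I.K i / T i ≤ ∑ i, I.H i * T i := by
  obtain ⟨⟨hT0, hTi, hα⟩, hopt⟩ := hT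
  have hscale : ∀ r : ℝ, 1 < r → (I.K₀ / Tmin + ∑ i, I.K i / T i) ≤ r * ∑ i, I.H i * T i := by
    intro r hr
    have hr0 : 0 < r := by linarith
    have h := hopt (r * Tmin) (fun i => r * T i) ⟨by positivity, fun i => by
      simpa using mul_le_mul_of_nonneg_left (hTi i) hr0.le, fun d => ?_⟩
    · have e : I.relaxObj (r * Tmin) (fun i => r * T i) =
          (I.K₀ / Tmin + ∑ i, I.K i / T i) / r + r * ∑ i, I.H i * T i := by
        rw [relaxObj, Finset.sum_add_distrib, add_div, Finset.sum_div, Finset.mul_sum, ← add_assoc]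
        congr 1
        · congr 1
          · rw [div_div, mul_comm]
          · exact Finset.sum_congr rfl fun i _ => by rw [div_div, mul_comm]
        · exact Finset.sum_congr rfl fun i _ => by ring
      rw [e, relaxObj, Finset.sum_add_distrib] at h
      set A := I.K₀ / Tmin + ∑ i, I.K i / T i
      set B := ∑ i, I.H i * T i
      have h1 : A + B ≤ A / r + r * B := by linarith
      have h2 : (r - 1) * A ≤ (r - 1) * (r * B) := by
        have := mul_le_mul_of_nonneg_right h1 hr0.le
        rw [add_mul _ (r * B), div_mul_cancel₀ _ hr0.ne'] at this
        linarith
      exact le_of_mul_le_mul_left h2 (by linarith)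
    · refine le_trans (Finset.sum_le_sum fun i _ => ?_) (hα d)
      have := hT0.trans_le (hTi i)
      exact div_le_div_of_nonneg_left (I.α_nonneg i d) this (by nlinarith)
  have hlim : Tendsto (fun r : ℝ => r * ∑ i, I.H i * T i) (𝓝[>] 1) (𝓝 (1 * ∑ i, I.H i * T i)) :=
    (tendsto_nhdsWithin_of_tendsto_nhds tendsto_id).mul_const _
  rw [one_mul] at hlim
  exact ge_of_tendsto hlim (by filter_upwards [self_mem_nhdsWithin] with r hr using hscale r hr)

theorem RelaxOptimal.relaxOPT_eq {I : RCJRP n D} {Tmin : ℝ} {T : Fin n → ℝ}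
    (hT : I.RelaxOptimal Tmin T) : I.relaxOPT = I.relaxObj Tmin T :=
  IsLeast.csInf_eq ⟨⟨Tmin, T, hT.1, rfl⟩, by rintro _ ⟨a, b, h, rfl⟩; exact hT.2 a b h⟩

theorem RelaxFeasible.resourceFeasible_shiftedPolicy {I : RCJRP n D} {Tmin : ℝ} {T : Fin n → ℝ}
    (hT : I.RelaxFeasible Tmin T) {N m k : ℕ} (hN : 1 ≤ N) (hm : 2 ≤ m) (hk : 1 ≤ k) (Θ : ℝ) :
    I.ResourceFeasible (shiftedPolicy N m k Θ Tmin T) := by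
  obtain ⟨hT0, hTi, hα⟩ := hT
  have hpos : ∀ i, 0 < T i := fun i => hT0.trans_le (hTi i)
  have hle : ∀ i, T i ≤ shiftedPolicy N m k Θ Tmin T i := fun i => by
    have h1 := (roundPow_isLeast hN (hpos i)).1.2
    have h2 := (roundPow_isLeast hN hT0).1.2
    exact h1.trans (roundGrid_isLeast hm hk Θ (hT0.trans_le h2) ((hpos i).trans_le h1)).1.2.le
  refine ⟨fun i => (hpos i).trans_le (hle i), fun d => le_trans (Finset.sum_le_sum fun i _ => ?_) (hα d)⟩
  exact div_le_div_of_nonneg_left (I.α_nonneg i d) (hpos i) (hle i)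

/-- The offset `a i` is the distance in exponent units between the rounded `T i` and the rounded
`Tmin`. It is chosen before `k`, `M`, `j`, `δ`, which is what allows bounds for different grids and
shifts to be combined. -/
theorem RelaxFeasible.exists_cost_shiftedPolicy_le {I : RCJRP n D} {Tmin : ℝ} {T : Fin n → ℝ}
    (hT : I.RelaxFeasible Tmin T) {N : ℕ} (hN : 1 ≤ N) :
    ∃ a : Fin n → ℤ, ∀ (k M : ℕ) (j : ℤ) (δ : ℝ), 0 < k → 0 < M → N = k * M → 0 < δ →
      δ < 1 → j < M →
      I.cost (shiftedPolicy N 2 k ((j + δ) / M) Tmin T) ≤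
        I.K₀ / Tmin * ((∑ l ∈ Finset.range k, ((2 : ℝ) ^ ((l : ℝ) / k))⁻¹) *
          ((2 : ℝ) ^ ((j + δ) / N : ℝ))⁻¹) +
        ∑ i, (I.K i / T i + I.H i * T i) *
          (2 ^ (1 / (N : ℝ)) * 2 ^ ((((j - a i) % M : ℤ) + δ) / N : ℝ)) := by
  have hT' := hT
  obtain ⟨hT0, hTi, hα⟩ := hT
  have hpos : ∀ i, 0 < T i := fun i => hT0.trans_le (hTi i)
  have hN0 : (0 : ℝ) < N := by exact_mod_cast hN
  obtain ⟨b, hb, hb1, hb2⟩ := exists_roundPow_eq hN hT0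
  choose c hc hc1 hc2 using fun i => exists_roundPow_eq hN (hpos i)
  have hbc : ∀ i, b ≤ c i := fun i => by
    have := roundPow_mono hN hT0 (hTi i)
    rw [hb, hc i, Real.rpow_le_rpow_left_iff one_lt_two, div_le_div_iff_of_pos_right hN0] at this
    exact_mod_cast this
  refine ⟨fun i => c i - b, fun k M j δ hk hM hNk hδ hδ' hj => ?_⟩
  have hpol : ∀ i, shiftedPolicy N 2 k ((j + δ) / M) Tmin T i =
      2 ^ ((((j - (c i - b)) % M : ℤ) + δ) / N) * 2 ^ ((c i : ℝ) / N) := fun i => by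
    rw [shiftedPolicy, hb, hc i, roundGrid_two_eq hk hM hNk j b (c i) hδ hδ']
  have hfeas := hT'.resourceFeasible_shiftedPolicy hN le_rfl hk ((j + δ) / M)
  have hdens := orderDensity_le_sum hfeas.1 (Finset.range k)
    (c := fun l => 2 ^ ((l : ℝ) / k) * (2 ^ ((j + δ) / N : ℝ) * 2 ^ ((b : ℝ) / N)))
    (fun l _ => by positivity)
    (fun i => by rw [hpol i]; exact two_rpow_grid_multiple hk hM hNk hj (hbc i) δ)
  rw [cost]
  refine add_le_add ?_ (Finset.sum_le_sum fun i _ => ?_)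
  · rw [div_mul_eq_mul_div, mul_div_assoc]
    refine mul_le_mul_of_nonneg_left (hdens.trans ?_) I.K₀_nonneg
    rw [← hb, Finset.sum_mul, Finset.sum_div]
    refine Finset.sum_le_sum fun l _ => ?_
    rw [mul_inv, mul_inv, ← mul_assoc, div_eq_mul_inv (_ * _) Tmin]
    exact mul_le_mul_of_nonneg_left (inv_anti₀ hT0 hb1) (by positivity)
  · set s := (j - (c i - b)) % M
    have hs0 : (0 : ℝ) ≤ s := by
      have : 0 ≤ s := Int.emod_nonneg _ (by positivity)
      exact_mod_cast this
    have hKT : 0 ≤ I.K i / T i := div_nonneg (I.K_pos i).le (hpos i).le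
    have hq : (1 : ℝ) ≤ 2 ^ (1 / (N : ℝ)) := Real.one_le_rpow one_le_two (by positivity)
    have hr : (1 : ℝ) ≤ 2 ^ ((s + δ) / N : ℝ) := Real.one_le_rpow one_le_two (by positivity)
    rw [hpol i, ← hc i, add_mul]
    refine add_le_add ?_ ?_
    -- The ordering term only decreases; it is nevertheless charged the full stretch, so that both
    -- terms carry one common factor.
    · have h1 : I.K i / (2 ^ ((s + δ) / N : ℝ) * roundPow N (T i)) ≤ I.K i / T i :=
        div_le_div_of_nonneg_left (I.K_pos i).le (hpos i)
          ((hc1 i).trans (le_mul_of_one_le_left ((hpos i).le.trans (hc1 i)) hr))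
      exact h1.trans (le_mul_of_one_le_right hKT (one_le_mul_of_one_le_of_one_le hq hr))
    · calc I.H i * (2 ^ ((s + δ) / N : ℝ) * roundPow N (T i))
          ≤ I.H i * (2 ^ ((s + δ) / N : ℝ) * (2 ^ (1 / (N : ℝ)) * T i)) :=
            mul_le_mul_of_nonneg_left (mul_le_mul_of_nonneg_left (hc2 i) (by positivity))
              (I.H_pos i).le
        _ = _ := by ring

end RCJRP

/-! ### Sums over residues. -/

theorem sum_range_sub_emod (M : ℕ) (a : ℤ) (g : ℤ → ℝ) :
    ∑ j ∈ Finset.range M, g (((j : ℤ) - a) % M) = ∑ j ∈ Finset.range M, g j := by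
  rcases M.eq_zero_or_pos with rfl | hM
  · simp
  have hMz : (0 : ℤ) < M := by exact_mod_cast hM
  refine Finset.sum_nbij' (fun j => (((j : ℤ) - a) % M).toNat) (fun j => (((j : ℤ) + a) % M).toNat)
    ?_ ?_ ?_ ?_ ?_
  · intro j _
    have h1 := Int.emod_nonneg ((j : ℤ) - a) hMz.ne'
    have h2 := Int.emod_lt_of_pos ((j : ℤ) - a) hMz
    exact Finset.mem_range.2 (by omega)
  · intro j _
    have h1 := Int.emod_nonneg ((j : ℤ) + a) hMz.ne'
    have h2 := Int.emod_lt_of_pos ((j : ℤ) + a) hMz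
    exact Finset.mem_range.2 (by omega)
  · intro j hj
    have hj := Finset.mem_range.1 hj
    have h1 := Int.emod_nonneg ((j : ℤ) - a) hMz.ne'
    rw [Int.toNat_of_nonneg h1, Int.emod_add_emod, sub_add_cancel,
      Int.emod_eq_of_lt (by omega) (by omega), Int.toNat_natCast]
  · intro j hj
    have hj := Finset.mem_range.1 hj
    have h1 := Int.emod_nonneg ((j : ℤ) + a) hMz.ne'
    rw [Int.toNat_of_nonneg h1, Int.emod_sub_emod, add_sub_cancel_right,
      Int.emod_eq_of_lt (by omega) (by omega), Int.toNat_natCast]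
  · intro j _
    rw [Int.toNat_of_nonneg (Int.emod_nonneg _ hMz.ne')]

/-- Modulo `2 * M`, the residues of `z` and `z + M` are `z % M` and `z % M + M`, in an order given
by the parity of `z / M`. This ties a pair of `k = 1` shifts to one `k = 2` shift. -/
theorem emod_two_mul_add_emod_two_mul (M : ℕ) (hM : 0 < M) (z : ℤ) (g : ℤ → ℝ) :
    g (z % (2 * M : ℕ)) + g ((z + M) % (2 * M : ℕ)) = g (z % M) + g (z % M + M) := by
  have hMz : (0 : ℤ) < M := by exact_mod_cast hM
  have h1 := Int.emod_nonneg z hMz.ne'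
  have h2 := Int.emod_lt_of_pos z hMz
  have h3 := Int.emod_add_mul_ediv z M
  obtain ⟨w, hw | hw⟩ := Int.even_or_odd' (z / M)
  · have e1 : z % (2 * M : ℕ) = z % M := by
      conv_lhs => rw [← h3, hw, show (M : ℤ) * (2 * w) = (2 * M : ℕ) * w by push_cast; ring]
      rw [Int.add_mul_emod_self_left, Int.emod_eq_of_lt h1 (by push_cast; omega)]
    have e2 : (z + M) % (2 * M : ℕ) = z % M + M := by
      conv_lhs => rw [← h3, hw, show z % M + (M : ℤ) * (2 * w) + M = z % M + M + (2 * M : ℕ) * w by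
        push_cast; ring]
      rw [Int.add_mul_emod_self_left, Int.emod_eq_of_lt (by omega) (by push_cast; omega)]
    rw [e1, e2]
  · have e1 : z % (2 * M : ℕ) = z % M + M := by
      conv_lhs => rw [← h3, hw, show z % M + (M : ℤ) * (2 * w + 1) = z % M + M + (2 * M : ℕ) * w by
        push_cast; ring]
      rw [Int.add_mul_emod_self_left, Int.emod_eq_of_lt (by omega) (by push_cast; omega)]
    have e2 : (z + M) % (2 * M : ℕ) = z % M := by
      conv_lhs => rw [← h3, hw, show z % M + (M : ℤ) * (2 * w + 1) + M =
        z % M + (2 * M : ℕ) * (w + 1) by push_cast; ring]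
      rw [Int.add_mul_emod_self_left, Int.emod_eq_of_lt h1 (by push_cast; omega)]
    rw [e1, e2, add_comm]

/-! ### Numerical estimates for the geometric sums. -/

theorem inv_one_sub_inv_two_rpow_le :
    (1 - ((2 : ℝ) ^ (1 / 2000 : ℝ))⁻¹)⁻¹ ≤ 2885.92 := by
  have hq : (1.000346633 : ℝ) ≤ 2 ^ (1 / 2000 : ℝ) := by
    rw [Real.rpow_def_of_pos two_pos]
    have h := Real.log_two_gt_d9
    have h1 := Real.quadratic_le_exp_of_nonneg (x := Real.log 2 * (1 / 2000)) (by linarith)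
    nlinarith
  have h1 : ((2 : ℝ) ^ (1 / 2000 : ℝ))⁻¹ ≤ 1.000346633⁻¹ := inv_anti₀ (by norm_num) hq
  rw [inv_le_comm₀ (by norm_num at h1 ⊢; linarith) (by norm_num)]
  norm_num at h1 ⊢
  linarith

theorem inv_two_rpow_pow_le : (((2 : ℝ) ^ (1 / 2000 : ℝ))⁻¹) ^ 259 ≤ 0.91415 := by
  have hq : (1.093913 : ℝ) ≤ (2 ^ (1 / 2000 : ℝ)) ^ 259 := by
    rw [← Real.rpow_natCast, ← Real.rpow_mul zero_le_two, Real.rpow_def_of_pos two_pos]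
    have h := Real.log_two_gt_d9
    have h0 : (0.0897625 : ℝ) ≤ Real.log 2 * (1 / 2000 * (259 : ℕ)) := by
      push_cast
      linarith
    refine le_trans ?_ (Real.exp_le_exp.2 h0)
    have h1 := Real.sum_le_exp_of_nonneg (x := 0.0897625) (by norm_num) 5
    refine le_trans ?_ h1
    norm_num [Finset.sum_range_succ, Nat.factorial]
  rw [inv_pow]
  refine (inv_anti₀ (by norm_num) hq).trans (by norm_num)

/-! ### The weighted average over shifts. -/

theorem mainTheorem4 {n D : ℕ} (I : RCJRP n D) (Tmin : ℝ) (T : Fin n → ℝ)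
    (hT : I.RelaxOptimal Tmin T) :
    ∃ Θ ∈ Set.Icc (0 : ℝ) 1,
      I.ResourceFeasible (shiftedPolicy 2000 2 1 Θ Tmin T) ∧
      I.ResourceFeasible (shiftedPolicy 2000 2 2 Θ Tmin T) ∧
      min (I.cost (shiftedPolicy 2000 2 1 Θ Tmin T)) (I.cost (shiftedPolicy 2000 2 2 Θ Tmin T))
        ≤ 1.2512 * I.relaxOPT := by
  have hpos : ∀ i, 0 < T i := fun i => hT.1.1.trans_le (hT.1.2.1 i)
  obtain ⟨a, ha⟩ := hT.1.exists_cost_shiftedPolicy_le (N := 2000) (by norm_num)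
  by_contra! hcon
  replace hcon : ∀ Θ ∈ Set.Icc (0 : ℝ) 1,
      1.2512 * I.relaxOPT < I.cost (shiftedPolicy 2000 2 1 Θ Tmin T) ∧
      1.2512 * I.relaxOPT < I.cost (shiftedPolicy 2000 2 2 Θ Tmin T) := fun Θ hΘ =>
    lt_min_iff.1 (hcon Θ hΘ
      (hT.1.resourceFeasible_shiftedPolicy (by norm_num) le_rfl le_rfl Θ)
      (hT.1.resourceFeasible_shiftedPolicy (by norm_num) le_rfl one_le_two Θ))
  set x := I.K₀ / Tmin with hx
  set c : Fin n → ℝ := fun i => I.K i / T i + I.H i * T i with hc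
  have hx0 : 0 ≤ x := div_nonneg I.K₀_nonneg hT.1.1.le
  have hOPT : I.relaxOPT = x + ∑ i, c i := hT.relaxOPT_eq
  have hxc : x ≤ ∑ i, c i := by
    have h1 := hT.ordering_le_holding
    have h2 : 0 ≤ ∑ i, I.K i / T i :=
      Finset.sum_nonneg fun i _ => div_nonneg (I.K_pos i).le (hpos i).le
    rw [hc, Finset.sum_add_distrib]
    linarith
  set O := I.relaxOPT
  set C := ∑ i, c i with hC
  set s := √(2 : ℝ) with hs
  have hss : s * s = 2 := Real.mul_self_sqrt zero_le_two
  have hs1 : 1.41421 ≤ s := Real.le_sqrt_of_sq_le (by norm_num)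
  have hs2 : s ≤ 1.41422 := Real.sqrt_le_iff.2 ⟨by norm_num, by norm_num⟩
  have hsinv : s⁻¹ = s / 2 := by
    rw [inv_eq_iff_eq_inv, inv_div, eq_div_iff (by linarith), hss]
  set q := (2 : ℝ) ^ (1 / 2000 : ℝ) with hq
  have hq1 : 1 < q := Real.one_lt_rpow one_lt_two (by norm_num)
  -- The sampled shifts use `δ = 1/10`, so `e = 2^(δ/2000)` is the resulting loss in every stretch
  -- factor.
  set e := (2 : ℝ) ^ (1 / 20000 : ℝ) with he
  have he1 : 1 ≤ e := Real.one_le_rpow one_le_two (by norm_num)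
  have he2 : e ≤ 1 + 1 / 20000 := by
    have := rpow_one_add_le_one_add_mul_self (s := 1) (p := 1 / 20000) (by norm_num)
      (by norm_num) (by norm_num)
    rw [one_add_one_eq_two] at this
    linarith
  have hq1000 : q ^ 1000 = s := by
    rw [hs, Real.sqrt_eq_rpow, hq, ← Real.rpow_natCast, ← Real.rpow_mul zero_le_two]
    norm_num
  set G : ℤ → ℝ := fun z => 2 ^ ((z + 1 / 10) / 2000 : ℝ) with hG
  have hGnat : ∀ j : ℕ, G j = e * q ^ j := fun j => by
    simp only [hG]
    rw [he, hq, ← Real.rpow_natCast, ← Real.rpow_mul zero_le_two, ← Real.rpow_add two_pos]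
    congr 1
    push_cast
    ring
  have hGadd : ∀ z, G (z + (1000 : ℕ)) = s * G z := fun z => by
    simp only [hG]
    rw [hs, Real.sqrt_eq_rpow, ← Real.rpow_add two_pos]
    congr 1
    push_cast
    ring
  set P : ℕ → ℝ := fun j => ∑ i, c i * (q * G ((j - a i) % (1000 : ℕ))) with hP
  have h1 : ∀ j : ℕ, j < 2000 →
      1.2512 * O < x * (G j)⁻¹ + ∑ i, c i * (q * G ((j - a i) % (2000 : ℕ))) := fun j hj => by
    have hj' : (j : ℝ) + 1 ≤ 2000 := by exact_mod_cast hj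
    refine (hcon _ ⟨?_, ?_⟩).1.trans_le ((ha 1 2000 j (1 / 10) one_pos (by norm_num) (by norm_num)
      (by norm_num) (by norm_num) (by exact_mod_cast hj)).trans_eq ?_)
    · positivity
    · push_cast
      rw [div_le_one (by norm_num)]
      linarith
    · simp [hG, hq, hc, hx]
  have h2 : ∀ j : ℕ, j < 1000 → 1.2512 * O < x * ((1 + s / 2) * (G j)⁻¹) + P j := fun j hj => by
    have hj' : (j : ℝ) + 1 ≤ 1000 := by exact_mod_cast hj
    refine (hcon _ ⟨?_, ?_⟩).2.trans_le ((ha 2 1000 j (1 / 10) two_pos (by norm_num) (by norm_num)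
      (by norm_num) (by norm_num) (by exact_mod_cast hj)).trans_eq ?_)
    · positivity
    · push_cast
      rw [div_le_one (by norm_num)]
      linarith
    · have : (2 : ℝ) ^ (2⁻¹ : ℝ) = s := by rw [hs, Real.sqrt_eq_rpow, one_div]
      simp [hG, hq, hc, hx, hP, Finset.sum_range_succ, this, hsinv]
  clear_value x s q e G P
  -- Sum of the `k = 1` bounds at `j` and `j + 1000`. The cutoff 259 is chosen so that both final
  -- estimates `n1` and `n2` hold: raising it lowers `W`, lowering it raises the joint cost.
  have h3 : ∀ j ∈ Finset.range 259,
      2 * (1.2512 * O) < x * ((1 + s / 2) * (G j)⁻¹) + (1 + s) * P j := fun j hj => by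
    have hj := Finset.mem_range.1 hj
    have e1 := h1 j (by omega)
    have e2 := h1 (j + 1000) (by omega)
    have e3 : ∑ i, c i * (q * G ((j - a i) % (2000 : ℕ))) +
        ∑ i, c i * (q * G (((j + 1000 : ℕ) - a i) % (2000 : ℕ))) = (1 + s) * P j := by
      rw [hP, ← Finset.sum_add_distrib, Finset.mul_sum]
      refine Finset.sum_congr rfl fun i _ => ?_
      have := emod_two_mul_add_emod_two_mul 1000 (by norm_num) (j - a i) G
      rw [hGadd, show (j : ℤ) - a i + (1000 : ℕ) = (j + 1000 : ℕ) - a i by push_cast; ring] at this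
      linear_combination (c i * q) * this
    have e4 : (G (j + 1000 : ℕ))⁻¹ = s / 2 * (G j)⁻¹ := by
      rw [Nat.cast_add, hGadd, mul_inv, hsinv]
    rw [e4] at e2
    linear_combination e1 + e2 + e3
  have h4 : ∀ j ∈ (Finset.Ico 259 1000 : Finset ℕ),
      (1 + s) * (1.2512 * O) < x * ((1 + s / 2) * ((1 + s) * (G j)⁻¹)) + (1 + s) * P j :=
    fun j hj => by
      have := mul_lt_mul_of_pos_left (h2 j (Finset.mem_Ico.1 hj).2) (show 0 < 1 + s by linarith)
      linarith
  have h5 := Finset.sum_lt_sum_of_nonempty (by simp) h3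
  have h6 := Finset.sum_lt_sum_of_nonempty (by simp) h4
  -- As `j` runs over a full period, the offsets `a i` drop out.
  have h7 : ∑ j ∈ Finset.range 1000, P j = C * (q * (e * ((s - 1) / (q - 1)))) := by
    rw [hP, Finset.sum_comm, hC, Finset.sum_mul]
    refine Finset.sum_congr rfl fun i _ => ?_
    rw [← Finset.mul_sum, ← Finset.mul_sum, sum_range_sub_emod 1000 (a i) G,
      Finset.sum_congr rfl fun j _ => hGnat j, ← Finset.mul_sum, geom_sum_eq hq1.ne', hq1000]
  rw [← Finset.sum_range_add_sum_Ico P (show 259 ≤ 1000 by norm_num)] at h7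
  have hGinv : ∀ j : ℕ, (G j)⁻¹ ≤ q⁻¹ ^ j := fun j => by
    rw [hGnat, inv_pow]
    exact inv_anti₀ (by positivity) (le_mul_of_one_le_left (by positivity) he1)
  have hr1 : q⁻¹ < 1 := inv_lt_one_of_one_lt₀ hq1
  set y := q⁻¹ ^ 259 with hy
  have h8 : ∑ j ∈ Finset.range 259, (G j)⁻¹ ≤ (1 - y) * (1 - q⁻¹)⁻¹ := by
    refine (Finset.sum_le_sum fun j _ => hGinv j).trans_eq ?_
    rw [geom_sum_eq hr1.ne, ← neg_div_neg_eq, neg_sub, neg_sub, div_eq_mul_inv]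
  have h9 : ∑ j ∈ (Finset.Ico 259 1000 : Finset ℕ), (G j)⁻¹ ≤ (y - s / 2) * (1 - q⁻¹)⁻¹ := by
    refine (Finset.sum_le_sum fun j _ => hGinv j).trans_eq ?_
    rw [geom_sum_Ico hr1.ne (by norm_num), ← neg_div_neg_eq, neg_sub, neg_sub, inv_pow q 1000,
      hq1000, hsinv, div_eq_mul_inv]
  simp only [Finset.sum_add_distrib, ← Finset.mul_sum, Finset.sum_const, Finset.card_range,
    Nat.card_Ico, nsmul_eq_mul] at h5 h6
  have hE : (1 - q⁻¹)⁻¹ = q / (q - 1) := by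
    rw [inv_eq_one_div, div_eq_div_iff (sub_pos.2 hr1).ne' (sub_pos.2 hq1).ne']
    field_simp
  have hy1 : y ≤ 0.91415 := by rw [hy, hq]; exact inv_two_rpow_pow_le
  clear_value y
  have hE1 := inv_one_sub_inv_two_rpow_le
  rw [← hq] at hE1
  set E := (1 - q⁻¹)⁻¹
  have hE0 : 0 < E := inv_pos.2 (sub_pos.2 hr1)
  -- Total weight: 259 pairs, and 741 `k = 2` shifts of weight `1 + s`.
  set W : ℝ := 518 + 741 * (1 + s) with hW
  clear_value E W
  -- Uses `(1 + s) * (s - 1) = 1`.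
  have hB : (1 + s) * (q * (e * ((s - 1) / (q - 1)))) = e * E := by
    rw [hE]
    linear_combination e * (q / (q - 1)) * hss
  have htot : W * (1.2512 * O) < x * ((1 / 2 + (y - 1 + s * y - s / 2)) * E) + C * (e * E) := by
    have k8 := mul_le_mul_of_nonneg_left h8 (show 0 ≤ x * (1 + s / 2) by positivity)
    have k9 := mul_le_mul_of_nonneg_left h9 (show 0 ≤ x * (1 + s / 2) * (1 + s) by positivity)
    have k7 : (1 + s) * (∑ j ∈ Finset.range 259, P j + ∑ j ∈ (Finset.Ico 259 1000 : Finset ℕ), P j) =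
        C * (e * E) := by
      rw [h7, ← hB]
      ring
    have k : x * (1 + s / 2) * ((1 - y) * E) + x * (1 + s / 2) * (1 + s) * ((y - s / 2) * E) =
        x * ((1 / 2 + (y - 1 + s * y - s / 2)) * E) := by
      linear_combination (x * E * (-3 / 4 - s / 4 + y / 2)) * hss
    norm_num at h5 h6
    rw [hW]
    linear_combination h5 + h6 + k8 + k9 + k7 + k
  have hWs : 2306.92 ≤ W := by linarith
  -- `n1` is the extreme case `x = 0` and `n2` the case `x = C`; the general case is their
  -- combination with weights `C - x` and `x`.
  have n1 : e * E ≤ 1.2512 * W := by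
    have : e * E ≤ (1 + 1 / 20000) * 2885.92 := mul_le_mul he2 hE1 hE0.le (by norm_num)
    linarith
  have n2 : (1 / 2 + (y - 1 + s * y - s / 2)) * E + e * E ≤ 2 * (1.2512 * W) := by
    have m1 : e * E ≤ (1 + 1 / 20000) * 2885.92 := mul_le_mul he2 hE1 hE0.le (by norm_num)
    have m2 : 1 / 2 + (y - 1 + s * y - s / 2) ≤ 0.9999 := by nlinarith
    have m3 := mul_le_mul m2 hE1 hE0.le (by norm_num)
    linarith
  have n3 := mul_le_mul_of_nonneg_left n1 (sub_nonneg.2 hxc)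
  have n4 := mul_le_mul_of_nonneg_left n2 hx0
  rw [hOPT] at htot
  linarith
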